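/- Let $S$ be a finite set, let $Q$ be an integral matrix with finitely many rows whose columns are indexed by $S$, and let $p$ be an integral vector indexed by the rows of $Q$. A rational linear system $Ax\ge b$ is totally dual integral (TDI) if, for every integral vector $c$ for which $\max\{yb : y\ge 0,\ yA=c\}$ is finite, this maximum is attained by an integral vector $y$. The system $Qx\ge p$ is box-TDI if the system $[Qx\ge p,\ f\le x\le g]$ is TDI for all (finite-valued) rational vectors $f\le g$ in $\mathbf{Q}^S$. **Theorem.** Suppose that $Qx\ge p$ is box-TDI, let $R:=\{x\in\mathbf{R}^S : Qx\ge p\}$, and let $z^*$ be an integral element of $R$. Let $\ell:S\to\mathbf{Z}\cup\{-\infty\}$ and $u:S\to\mathbf{Z}\cup\{+\infty\}$ satisfy $\ell\le u$. For $X\subseteq S$ let $\chi_X$ denote the characteristic vector of $X$, and put $\widetilde\ell(X)=\sum_{s\in X}\ell(s)$ and $\widetilde u(X)=\sum_{s\in X}u(s)$ (empty sums are $0$). Consider the condition $(\ast)$ $\widetilde\ell(S^-)\le\widetilde u(S^+)$ for every pair $(S^-,S^+)$ of disjoint subsets of $S$ for which $z^*+\chi_{S^+}-\chi_{S^-}\in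 R$. 1. There exists an integral vector $y^*\ge 0$ with $\ell\le y^*Q\le u$ and $y^*(Qz^*-p)=0$ if and only if $(\ast)$ holds. 2. There exists an integral vector $w^*\in\mathbf{Z}^S$ with $\ell\le w^*\le u$ for which $z^*$ is a $w^*$-minimizer of $R$ (that is, $w^*z^*\le w^*x$ for every $x\in R$) if and only if $(\ast)$ holds. -/

import Mathlib

open scoped Matrix

namespace BoxTDI

/-- The polyhedron `{x : A x ≥ b}` in real space, for a rational system `A x ≥ b`. -/
def polyhedron {m n : Type*} [Fintype n] (A : Matrix m n ℚ) (b : m → ℚ) : Set (n → ℝ) :=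
  {x | ∀ i, (b i : ℝ) ≤ (A.map (fun q : ℚ => (q : ℝ)) *ᵥ x) i}

/-- The feasible set `{y : y ≥ 0, y A = c}` of the dual of `min {c x : A x ≥ b}`. -/
def dualFeasible {m n : Type*} [Fintype m] (A : Matrix m n ℚ) (c : n → ℝ) : Set (m → ℝ) :=
  {y | (∀ i, 0 ≤ y i) ∧ y ᵥ* A.map (fun q : ℚ => (q : ℝ)) = c}

/-- The objective value `y b` of the dual program. -/
def dualObjective {m : Type*} [Fintype m] (b : m → ℚ) (y : m → ℝ) : ℝ :=
  y ⬝ᵥ fun i => (b i : ℝ)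

/-- The rational system `A x ≥ b` is totally dual integral: for every integral `c` for which
`max {y b : y ≥ 0, y A = c}` is finite (the dual program is feasible and bounded from above),
this maximum is attained by an integral `y`. -/
def IsTDI {m n : Type*} [Fintype m] (A : Matrix m n ℚ) (b : m → ℚ) : Prop :=
  ∀ c : n → ℤ,
    (dualFeasible A fun s => (c s : ℝ)).Nonempty →
    BddAbove (dualObjective b '' dualFeasible A fun s => (c s : ℝ)) →
    ∃ y : m → ℤ,
      (fun i => (y i : ℝ)) ∈ dualFeasible A (fun s => (c s : ℝ)) ∧
      ∀ y' ∈ dualFeasible A (fun s => (c s : ℝ)),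
        dualObjective b y' ≤ dualObjective b fun i => (y i : ℝ)

/-- The constraint matrix of the system `[A x ≥ b, x ≥ f, -x ≥ -g]`. -/
def boxMatrix {m n : Type*} [DecidableEq n] (A : Matrix m n ℚ) : Matrix (m ⊕ n ⊕ n) n ℚ :=
  Matrix.fromRows A (Matrix.fromRows 1 (-1))

/-- The right-hand side of the system `[A x ≥ b, x ≥ f, -x ≥ -g]`. -/
def boxRhs {m n : Type*} (b : m → ℚ) (f g : n → ℚ) : m ⊕ n ⊕ n → ℚ :=
  Sum.elim b (Sum.elim f (-g))

/-- The system `A x ≥ b` is box-totally dual integral: `[A x ≥ b, f ≤ x ≤ g]` is totally dual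
integral for all finite rational bounds `f ≤ g`. -/
def IsBoxTDI {m n : Type*} [Fintype m] [Fintype n] [DecidableEq n]
    (A : Matrix m n ℚ) (b : m → ℚ) : Prop :=
  ∀ f g : n → ℚ, f ≤ g → IsTDI (boxMatrix A) (boxRhs b f g)

/-- A matrix with integral entries, as a rational matrix. -/
def ratMatrix {m n : Type*} (Q : Matrix m n ℤ) : Matrix m n ℚ := Q.map fun k : ℤ => (k : ℚ)

/-- An integral vector, as a rational vector. -/
def ratVec {m : Type*} (p : m → ℤ) : m → ℚ := fun i => (p i : ℚ)

/-- An integral vector, as a real vector. -/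
def realVec {n : Type*} (z : n → ℤ) : n → ℝ := fun s => (z s : ℝ)

/-- `z` is a `w`-minimizer of the set `R`. -/
def IsMinimizer {n : Type*} [Fintype n] (R : Set (n → ℝ)) (w z : n → ℝ) : Prop :=
  z ∈ R ∧ ∀ x ∈ R, w ⬝ᵥ z ≤ w ⬝ᵥ x

/-- The characteristic vector of a subset of the ground set. -/
noncomputable def charVec {n : Type*} (X : Finset n) : n → ℝ := Set.indicator (X : Set n) 1

/-- Comparison of `a ∈ ℤ ∪ {-∞}` with `b ∈ ℤ ∪ {+∞}`, in the extended integers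
`ℤ ∪ {-∞, +∞}`. -/
def ExtLE (a : WithBot ℤ) (b : WithTop ℤ) : Prop :=
  WithBot.map (fun k : ℤ => (WithTop.some k)) a ≤ (WithBot.some b : WithBot (WithTop ℤ))

theorem extLE_coe (a b : ℤ) : ExtLE (WithBot.some a) (WithTop.some b) ↔ a ≤ b := by
  simp [ExtLE]

theorem extLE_bot (b : WithTop ℤ) : ExtLE ⊥ b := by
  simp [ExtLE]

theorem extLE_top (a : WithBot ℤ) : ExtLE a ⊤ := by
  cases a <;> simp [ExtLE]

/-- The integral vector `w` lies between the possibly infinite bounds `l` and `u`. -/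
def IsBetween {n : Type*} (l : n → WithBot ℤ) (u : n → WithTop ℤ) (w : n → ℤ) : Prop :=
  ∀ s, l s ≤ WithBot.some (w s) ∧ WithTop.some (w s) ≤ u s

/-- The sum of `l` over `Sm` is at most the sum of `u` over `Sp`, for every pair of disjoint
sets `Sm`, `Sp` such that adding the characteristic vector of `Sp` to `z` and subtracting that
of `Sm` gives an element of `R`. -/
def PairCondition {n : Type*} (R : Set (n → ℝ)) (z : n → ℤ)
    (l : n → WithBot ℤ) (u : n → WithTop ℤ) : Prop :=
  ∀ Sm Sp : Finset n, Disjoint Sm Sp →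
    realVec z + charVec Sp - charVec Sm ∈ R →
    ExtLE (∑ s ∈ Sm, l s) (∑ s ∈ Sp, u s)

end BoxTDI

/-! Necessity of the pair condition: an integral `y` complementary to `z` makes `z` a
`yQ`-minimizer. If `z` is a `w`-minimizer with `l ≤ w ≤ u`, comparing `z` with `z + χ_{S⁺} - χ_{S⁻}`
gives `w(S⁻) ≤ w(S⁺)`, hence the condition.

Sufficiency has two stages.

Real solution (`exists_real_dual`): if no `y ≥ 0` supported on the rows tight at `z` satisfies `l ≤
yQ ≤ u`, Farkas' lemma yields a direction `d`, allowed by the tight rows, of negative cost, where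
raising `s` costs `u s` and lowering it saves `l s`. A small step along `d` stays in `R` and in a
unit box around `z`. Box-TDI systems with integral data are integral over integral boxes
(`exists_int_le`), so some integral point of that box also has negative cost. It is `z` plus a
difference of characteristic vectors, against the pair condition (`cost_nonneg`).

Rounding (`exists_int_dual_of_real`): TDI over a suitable box gives an integral `y'` agreeing with
`yQ` wherever `yQ` is integral. Moving from `y` towards `y'` until a further coordinate of `yQ`
becomes integral crosses no integral bound; iterating makes `yQ` integral, and then `y'` itself has
the same product. -/

namespace BoxTDI

/-! ### Farkas' lemma and its affine forms -/

/-- **Farkas' lemma** for finitely many linear functionals on a real vector space. -/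
theorem exists_nonneg_combination {V ι : Type*} [AddCommGroup V] [Module ℝ V] (s : Finset ι) :
    ∀ (a : ι → V →ₗ[ℝ] ℝ) (c : V →ₗ[ℝ] ℝ), (∀ x, (∀ i ∈ s, 0 ≤ a i x) → 0 ≤ c x) →
      ∃ r : ι → ℝ, (∀ i, 0 ≤ r i) ∧ ∀ x, c x = ∑ i ∈ s, r i * a i x := by
  classical
  induction s using Finset.induction_on with
  | empty =>
    intro a c h
    refine ⟨0, fun _ => le_rfl, fun x => ?_⟩
    have h1 := h x (by simp)
    have h2 := h (-x) (by simp)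
    rw [map_neg] at h2
    simp only [Finset.sum_empty]
    linarith
  | insert j s hj ih =>
    intro a c h
    by_cases hs : ∀ x, (∀ i ∈ s, 0 ≤ a i x) → 0 ≤ c x
    · obtain ⟨r, hr, hc⟩ := ih a c hs
      refine ⟨Function.update r j 0, fun i => ?_, fun x => ?_⟩
      · by_cases hij : i = j
        · simp [hij]
        · simp [hij, hr i]
      · rw [Finset.sum_insert hj, hc x]
        simp only [Function.update_self, zero_mul, zero_add]
        refine Finset.sum_congr rfl fun i hi => ?_
        rw [Function.update_of_ne (ne_of_mem_of_not_mem hi hj)]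
    · push Not at hs
      obtain ⟨v, hv, hcv⟩ := hs
      have hav : a j v < 0 := by
        by_contra hav
        refine absurd (h v fun i hi => ?_) (not_le.2 hcv)
        rcases Finset.mem_insert.1 hi with rfl | hi
        · exact not_lt.1 hav
        · exact hv i hi
      -- The map `x ↦ x + (q * a j x) • v` projects onto the kernel of `a j` along `v`, so induction
      -- applies to the functionals composed with it.
      set q : ℝ := (-a j v)⁻¹ with hq
      have hq0 : 0 < q := inv_pos.2 (neg_pos.2 hav)
      have hqa : q * a j v = -1 := by 
        rw [hq, inv_neg, neg_mul, inv_mul_cancel₀ hav.ne]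
      obtain ⟨r, hr, hc⟩ := ih (fun i => a i + (q * a i v) • a j) (c + (q * c v) • a j) (by
        intro x hx
        have := h (x + (q * a j x) • v) (fun i hi => by
          rcases Finset.mem_insert.1 hi with rfl | hi
          · simp only [map_add, map_smul, smul_eq_mul]
            have : q * a i x * a i v = a i x * (q * a i v) := by ring
            rw [this, hqa]; simp
          · have := hx i hi
            simp only [LinearMap.add_apply, LinearMap.smul_apply, smul_eq_mul] at this
            simp only [map_add, map_smul, smul_eq_mul]
            linarith)
        simp only [map_add, map_smul, smul_eq_mul] at this
        simp only [LinearMap.add_apply, LinearMap.smul_apply, smul_eq_mul]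
        linarith)
      have hpos : 0 ≤ ∑ i ∈ s, r i * (q * a i v) - q * c v := by
        have h1 : 0 ≤ ∑ i ∈ s, r i * (q * a i v) :=
          Finset.sum_nonneg fun i hi => mul_nonneg (hr i) (mul_nonneg hq0.le (hv i hi))
        have h2 : q * c v < 0 := mul_neg_of_pos_of_neg hq0 hcv
        linarith
      refine ⟨Function.update r j (∑ i ∈ s, r i * (q * a i v) - q * c v), fun i => ?_,
        fun x => ?_⟩
      · by_cases hij : i = j
        · subst hij; simpa using hpos
        · simp [hij, hr i]
      · rw [Finset.sum_insert hj, Function.update_self]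
        have hsum : ∑ i ∈ s, Function.update r j (∑ i ∈ s, r i * (q * a i v) - q * c v) i * a i x
            = ∑ i ∈ s, r i * a i x := Finset.sum_congr rfl fun i hi => by
          rw [Function.update_of_ne (ne_of_mem_of_not_mem hi hj)]
        have hcx := hc x
        simp only [LinearMap.add_apply, LinearMap.smul_apply, smul_eq_mul, mul_add,
          Finset.sum_add_distrib] at hcx
        have hfac : ∑ i ∈ s, r i * (q * a i v * a j x) = (∑ i ∈ s, r i * (q * a i v)) * a j x := by
          rw [Finset.sum_mul]
          exact Finset.sum_congr rfl fun i _ => by ring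
        rw [hsum, sub_mul]
        linarith

/-- Farkas' lemma for the homogenization of the system `A x ≥ b`. -/
theorem exists_dual_of_homogeneous {ι n : Type*} [Fintype ι] [Fintype n]
    (A : Matrix ι n ℝ) (b : ι → ℝ) (c : n → ℝ) (δ : ℝ)
    (h : ∀ (x : n → ℝ) (t : ℝ), 0 ≤ t → (∀ i, b i * t ≤ (A *ᵥ x) i) → δ * t ≤ c ⬝ᵥ x) :
    ∃ y : ι → ℝ, (∀ i, 0 ≤ y i) ∧ y ᵥ* A = c ∧ δ ≤ y ⬝ᵥ b := by
  classical
  let row (v : n → ℝ) (e : ℝ) : ((n → ℝ) × ℝ) →ₗ[ℝ] ℝ :=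
    (dotProductBilin ℝ ℝ v).comp (LinearMap.fst ℝ _ _) - e • LinearMap.snd ℝ _ _
  have hrow : ∀ v e x t, row v e (x, t) = v ⬝ᵥ x - e * t := fun v e x t => by
    simp [row]
  -- The index `none` carries the functional `t`, encoding `0 ≤ t`; its multiplier is the gap
  -- between `δ` and `y ⬝ᵥ b`.
  obtain ⟨r, hr, hc⟩ := exists_nonneg_combination (Finset.univ : Finset (Option ι))
    (fun o => o.elim (row 0 (-1)) fun i => row (A i) (b i)) (row c δ) (by
      rintro ⟨x, t⟩ hx
      have h0 := hx none (Finset.mem_univ _)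
      simp only [Option.elim_none, hrow, zero_dotProduct] at h0
      rw [hrow]
      have := h x t (by linarith) (fun i => by
        have := hx (some i) (Finset.mem_univ _)
        simp only [Option.elim_some, hrow] at this
        simp only [Matrix.mulVec]
        linarith)
      linarith)
  refine ⟨fun i => r (some i), fun i => hr _, ?_, ?_⟩
  · ext s
    have := hc (Pi.single s 1, 0)
    simp only [Fintype.sum_option, Option.elim_none, Option.elim_some, hrow,
      Pi.zero_apply, zero_add, dotProduct_single, mul_one, mul_zero, sub_zero] at this
    rw [this]
    rfl
  · have := hc (0, 1)
    simp only [Fintype.sum_option, Option.elim_none, Option.elim_some, hrow,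
      dotProduct_zero, mul_one, zero_sub, neg_neg, mul_neg, Finset.sum_neg_distrib] at this
    have h0 := hr none
    simp only [dotProduct]
    linarith

/-- Affine Farkas' lemma: an inequality implied by a feasible system is dominated by a
nonnegative combination of its rows. -/
theorem exists_dual_of_implied {ι n : Type*} [Fintype ι] [Fintype n]
    (A : Matrix ι n ℝ) (b : ι → ℝ) (c : n → ℝ) (δ : ℝ) (hne : ∃ x, ∀ i, b i ≤ (A *ᵥ x) i)
    (h : ∀ x, (∀ i, b i ≤ (A *ᵥ x) i) → δ ≤ c ⬝ᵥ x) :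
    ∃ y : ι → ℝ, (∀ i, 0 ≤ y i) ∧ y ᵥ* A = c ∧ δ ≤ y ⬝ᵥ b := by
  refine exists_dual_of_homogeneous A b c δ fun x t ht hx => ?_
  rcases ht.eq_or_lt with rfl | ht
  · obtain ⟨x₀, hx₀⟩ := hne
    rw [mul_zero]
    by_contra hneg
    push Not at hneg
    -- Here `x` is a recession direction; if `c` decreased along it, a long enough ray from `x₀`
    -- would reach the value `δ - 1`.
    have key : ∀ k : ℝ, 0 ≤ k → δ ≤ c ⬝ᵥ x₀ + k * c ⬝ᵥ x := fun k hk => by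
      have := h (x₀ + k • x) fun i => by
        have h1 := hx i
        rw [mul_zero] at h1
        have h2 := mul_nonneg hk h1
        rw [Matrix.mulVec_add, Matrix.mulVec_smul]
        simp only [Pi.add_apply, Pi.smul_apply, smul_eq_mul]
        linarith [hx₀ i]
      rwa [dotProduct_add, dotProduct_smul, smul_eq_mul] at this
    have h1 := h x₀ hx₀
    have h2 := key ((c ⬝ᵥ x₀ - δ + 1) / (-(c ⬝ᵥ x))) (div_nonneg (by linarith) (by linarith))
    have h3 : (c ⬝ᵥ x₀ - δ + 1) / (-(c ⬝ᵥ x)) * c ⬝ᵥ x = -(c ⬝ᵥ x₀ - δ + 1) := by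
      field_simp [hneg.ne]
    linarith
  · have := h (t⁻¹ • x) fun i => by
      rw [Matrix.mulVec_smul, Pi.smul_apply, smul_eq_mul, ← div_eq_inv_mul, le_div_iff₀ ht]
      exact hx i
    rwa [dotProduct_smul, smul_eq_mul, ← div_eq_inv_mul, le_div_iff₀ ht] at this

/-- Farkas' lemma: certificate of infeasibility of the system `A x ≥ b`. -/
theorem exists_infeasibility_certificate {ι n : Type*} [Fintype ι] [Fintype n]
    (A : Matrix ι n ℝ) (b : ι → ℝ) (h : ¬ ∃ x, ∀ i, b i ≤ (A *ᵥ x) i) :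
    ∃ y : ι → ℝ, (∀ i, 0 ≤ y i) ∧ y ᵥ* A = 0 ∧ 0 < y ⬝ᵥ b := by
  obtain ⟨y, hy, hyA, hyb⟩ := exists_dual_of_homogeneous A b 0 1 fun x t ht hx => by
    rcases ht.eq_or_lt with rfl | ht
    · simp
    · refine absurd ⟨t⁻¹ • x, fun i => ?_⟩ h
      rw [Matrix.mulVec_smul, Pi.smul_apply, smul_eq_mul, ← div_eq_inv_mul, le_div_iff₀ ht]
      exact hx i
  exact ⟨y, hy, hyA, by linarith⟩

theorem boxRhs_ratVec {m n : Type*} (b : m → ℤ) (f g : n → ℤ) :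
    boxRhs (ratVec b) (ratVec f) (ratVec g) = ratVec (Sum.elim b (Sum.elim f (-g))) := by
  ext (i | i | i) <;> simp [boxRhs, ratVec]

/-! ### Integral duals and lexicographic optimization -/

section Duality

variable {m n : Type*} [Fintype n]

theorem dualObjective_le [Fintype m] (A : Matrix m n ℚ) (b : m → ℚ) {c x : n → ℝ} {y : m → ℝ}
    (hy : y ∈ dualFeasible A c) (hx : x ∈ polyhedron A b) : dualObjective b y ≤ c ⬝ᵥ x := by
  rw [← hy.2, ← Matrix.dotProduct_mulVec]
  exact Finset.sum_le_sum fun i _ => mul_le_mul_of_nonneg_left (hx i) (hy.1 i)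

/-- An integral minimization problem over a totally dual integral system has an integral dual
solution attaining the minimum. -/
theorem IsTDI.exists_int_dual [Fintype m] {A : Matrix m n ℚ} {b : m → ℚ} (h : IsTDI A b) (c : n → ℤ)
    {x : n → ℝ} (hx : x ∈ polyhedron A b)
    (hmin : ∀ x' ∈ polyhedron A b, realVec c ⬝ᵥ x ≤ realVec c ⬝ᵥ x') :
    ∃ y : m → ℤ, realVec y ∈ dualFeasible A (realVec c) ∧
      dualObjective b (realVec y) = realVec c ⬝ᵥ x := by
  obtain ⟨y, hy0, hyA, hyb⟩ := exists_dual_of_implied (A.map fun q : ℚ => (q : ℝ))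
    (fun i => (b i : ℝ)) (realVec c) (realVec c ⬝ᵥ x) ⟨x, hx⟩ hmin
  have hy : y ∈ dualFeasible A (realVec c) := ⟨hy0, hyA⟩
  obtain ⟨z, hz, hzmax⟩ := h c ⟨y, hy⟩
    ⟨realVec c ⬝ᵥ x, by rintro _ ⟨y', hy', rfl⟩; exact dualObjective_le A b hy' hx⟩
  exact ⟨z, hz, le_antisymm (dualObjective_le A b hz hx) (hyb.trans (hzmax y hy))⟩

/-- The optimum value of an integral linear function over a totally dual integral system with
integral right-hand side is an integer. -/
theorem IsTDI.exists_int_eq_min [Fintype m] {A : Matrix m n ℚ} {b : m → ℤ} (h : IsTDI A (ratVec b))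
    (c : n → ℤ) {x : n → ℝ} (hx : x ∈ polyhedron A (ratVec b))
    (hmin : ∀ x' ∈ polyhedron A (ratVec b), realVec c ⬝ᵥ x ≤ realVec c ⬝ᵥ x') :
    ∃ k : ℤ, realVec c ⬝ᵥ x = k := by
  obtain ⟨y, -, hy⟩ := h.exists_int_dual c hx hmin
  refine ⟨y ⬝ᵥ b, hy ▸ ?_⟩
  simp [dualObjective, dotProduct, ratVec, realVec]

theorem isClosed_polyhedron (A : Matrix m n ℚ) (b : m → ℚ) : IsClosed (polyhedron A b) := by
  simp only [polyhedron, Set.ofPred_forall]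
  refine isClosed_iInter fun i => isClosed_le continuous_const ?_
  simp only [Matrix.mulVec, dotProduct]
  fun_prop

/-- If `x` minimizes `a` over a polyhedron and minimizes `e` among the minimizers of `a`, then it
minimizes `e + N a` for all large `N`. -/
theorem exists_lex_weight [Fintype m] (A : Matrix m n ℚ) (b : m → ℚ) (a e : n → ℝ) {x : n → ℝ}
    (hx : x ∈ polyhedron A b) (hmin : ∀ x' ∈ polyhedron A b, a ⬝ᵥ x ≤ a ⬝ᵥ x')
    (hlex : ∀ x' ∈ polyhedron A b, a ⬝ᵥ x' = a ⬝ᵥ x → e ⬝ᵥ x ≤ e ⬝ᵥ x') :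
    ∃ N : ℕ, ∀ x' ∈ polyhedron A b, (e + (N : ℝ) • a) ⬝ᵥ x ≤ (e + (N : ℝ) • a) ⬝ᵥ x' := by
  let B : Matrix (m ⊕ Unit) n ℝ :=
    Matrix.fromRows (A.map fun q : ℚ => (q : ℝ)) (Matrix.of fun _ => -a)
  have hB : ∀ x' : n → ℝ, (∀ i, Sum.elim (fun i => (b i : ℝ)) (fun _ => -(a ⬝ᵥ x)) i ≤
      (B *ᵥ x') i) ↔ x' ∈ polyhedron A b ∧ a ⬝ᵥ x' ≤ a ⬝ᵥ x := fun x' => by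
    have hneg : (fun j => -a j) ⬝ᵥ x' = -(a ⬝ᵥ x') := neg_dotProduct a x'
    simp [B, polyhedron, Matrix.mulVec, hneg]
  obtain ⟨y, hy0, hyB, hyb⟩ := exists_dual_of_implied B _ e (e ⬝ᵥ x)
    ⟨x, (hB x).2 ⟨hx, le_rfl⟩⟩ fun x' hx' => by
      obtain ⟨h1, h2⟩ := (hB x').1 hx'
      exact hlex x' h1 (le_antisymm h2 (hmin x' h1))
  -- `y (Sum.inr ())` is the multiplier of `a x' ≤ a x`. Once `N` exceeds it, `e + N a` is a
  -- nonnegative combination of the rows of `A` plus a nonnegative multiple of `a`.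
  refine ⟨⌈y (Sum.inr ())⌉₊, fun x' hx' => ?_⟩
  have hN : y (Sum.inr ()) ≤ ⌈y (Sum.inr ())⌉₊ := Nat.le_ceil _
  set N : ℝ := (⌈y (Sum.inr ())⌉₊ : ℝ)
  have h1 : e ⬝ᵥ x' = ∑ i, y (Sum.inl i) * (A.map (fun q : ℚ => (q : ℝ)) *ᵥ x') i
      - y (Sum.inr ()) * a ⬝ᵥ x' := by
    rw [← hyB, ← Matrix.dotProduct_mulVec, Matrix.fromRows_mulVec]
    simp [dotProduct, Matrix.mulVec, Finset.sum_neg_distrib, sub_eq_add_neg]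
  have h2 : y ⬝ᵥ Sum.elim (fun i => (b i : ℝ)) (fun _ => -(a ⬝ᵥ x)) =
      ∑ i, y (Sum.inl i) * (b i : ℝ) - y (Sum.inr ()) * a ⬝ᵥ x := by
    simp only [dotProduct, Fintype.sum_sum_type, Sum.elim_inl, Sum.elim_inr,
      Finset.univ_unique, Finset.sum_singleton]
    simp [sub_eq_add_neg]
  rw [h2] at hyb
  have h3 : ∑ i, y (Sum.inl i) * (b i : ℝ) ≤
      ∑ i, y (Sum.inl i) * (A.map (fun q : ℚ => (q : ℝ)) *ᵥ x') i :=
    Finset.sum_le_sum fun i _ => mul_le_mul_of_nonneg_left (hx' i) (hy0 _)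
  have h4 : 0 ≤ (N - y (Sum.inr ())) * (a ⬝ᵥ x' - a ⬝ᵥ x) :=
    mul_nonneg (sub_nonneg.2 hN) (sub_nonneg.2 (hmin x' hx'))
  simp only [add_dotProduct, smul_dotProduct, smul_eq_mul]
  linarith

end Duality

/-! ### Integrality over integral boxes -/

section Box

variable {m n : Type*} [Fintype n] [DecidableEq n]

theorem mem_polyhedron_box {A : Matrix m n ℚ} {b : m → ℚ} {f g : n → ℚ} {x : n → ℝ} :
    x ∈ polyhedron (boxMatrix A) (boxRhs b f g) ↔
      x ∈ polyhedron A b ∧ (∀ s, (f s : ℝ) ≤ x s) ∧ ∀ s, x s ≤ g s := by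
  have h1 : ((1 : Matrix n n ℚ).map fun q : ℚ => (q : ℝ)) = 1 :=
    Matrix.map_one _ Rat.cast_zero Rat.cast_one
  have h2 : ((-1 : Matrix n n ℚ).map fun q : ℚ => (q : ℝ)) = -1 := by
    ext i j; by_cases h : i = j <;> simp [h]
  simp only [polyhedron, boxMatrix, boxRhs, Set.mem_ofPred_eq, Sum.forall, Sum.elim_inl,
    Sum.elim_inr, Matrix.fromRows_map, Matrix.fromRows_mulVec, h1, h2, Matrix.one_mulVec,
    Matrix.neg_mulVec, Pi.neg_apply, Rat.cast_neg, neg_le_neg_iff]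

theorem isCompact_polyhedron_box (A : Matrix m n ℚ) (b : m → ℚ) (f g : n → ℚ) :
    IsCompact (polyhedron (boxMatrix A) (boxRhs b f g)) := by
  refine (isCompact_Icc (a := fun s => (f s : ℝ)) (b := fun s => (g s : ℝ))).of_isClosed_subset
    (isClosed_polyhedron _ _) fun x hx => ?_
  rw [mem_polyhedron_box] at hx
  exact ⟨hx.2.1, hx.2.2⟩

/-- Integrality of box-totally dual integral systems with integral right-hand side: over an
integral box, the minimum of an integral linear function is attained by an integral vector. -/
theorem IsBoxTDI.exists_int_le [Fintype m] {A : Matrix m n ℚ} {b : m → ℤ} (hA : IsBoxTDI A (ratVec b))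
    (a : n → ℤ) (f g : n → ℤ) {x : n → ℝ} (hx : x ∈ polyhedron A (ratVec b))
    (hf : ∀ s, (f s : ℝ) ≤ x s) (hg : ∀ s, x s ≤ g s) :
    ∃ v : n → ℤ, realVec v ∈ polyhedron A (ratVec b) ∧ f ≤ v ∧ v ≤ g ∧
      realVec a ⬝ᵥ realVec v ≤ realVec a ⬝ᵥ x := by
  induction hk : (Finset.univ.filter fun s => f s ≠ g s).card using Nat.strong_induction_on
    generalizing f g x with
  | _ k ih =>
  have hfg : f ≤ g := fun s => by exact_mod_cast (hf s).trans (hg s)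
  by_cases hall : ∀ s, f s = g s
  · have hxf : x = realVec f := funext fun s => le_antisymm (by
      rw [realVec, hall s]; exact hg s) (hf s)
    exact ⟨f, hxf ▸ hx, le_rfl, hfg, by rw [hxf]⟩
  push Not at hall
  obtain ⟨s, hs⟩ := hall
  have hTDI := hA (ratVec f) (ratVec g) fun s => by simpa [ratVec] using hfg s
  have hcomp := isCompact_polyhedron_box A (ratVec b) (ratVec f) (ratVec g)
  have hmem : ∀ x' : n → ℝ, x' ∈ polyhedron (boxMatrix A) (boxRhs (ratVec b) (ratVec f)
      (ratVec g)) ↔ x' ∈ polyhedron A (ratVec b) ∧ (∀ s, (f s : ℝ) ≤ x' s) ∧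
        ∀ s, x' s ≤ g s := fun x' => by
    rw [mem_polyhedron_box]; simp [ratVec]
  rw [boxRhs_ratVec] at hTDI hcomp hmem
  set P := polyhedron (boxMatrix A) (ratVec (Sum.elim b (Sum.elim f (-g)))) with hP
  have hcont : ∀ c : n → ℝ, Continuous fun x : n → ℝ => c ⬝ᵥ x := fun c => by
    simp only [dotProduct]; fun_prop
  have hxP : x ∈ P := (hmem x).2 ⟨hx, hf, hg⟩
  -- Among the minimizers of `a`, choose `x₂` with least coordinate `s`. It minimizes both `a` and
  -- `e_s + N a`, whose optimal values are integers by TDI, so `x₂ s` is an integer. Pinning that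
  -- coordinate shrinks the induction measure.
  obtain ⟨x₁, hx₁, hmin₁⟩ := hcomp.exists_isMinOn ⟨x, hxP⟩ (hcont (realVec a)).continuousOn
  have hFcomp : IsCompact (P ∩ {x' | realVec a ⬝ᵥ x' = realVec a ⬝ᵥ x₁}) :=
    hcomp.inter_right (isClosed_eq (hcont _) continuous_const)
  obtain ⟨x₂, ⟨hx₂, hx₂a⟩, hmin₂⟩ := hFcomp.exists_isMinOn ⟨x₁, hx₁, rfl⟩
    (hcont (realVec (Pi.single s 1))).continuousOn
  simp only [Set.mem_ofPred_eq] at hx₂a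
  have hmin : ∀ x' ∈ P, realVec a ⬝ᵥ x₂ ≤ realVec a ⬝ᵥ x' := fun x' hx' => hx₂a ▸ hmin₁ hx'
  obtain ⟨N, hN⟩ := exists_lex_weight (boxMatrix A) _ (realVec a) (realVec (Pi.single s 1)) hx₂
    hmin fun x' hx' h => hmin₂ ⟨hx', h.trans hx₂a⟩
  obtain ⟨k₁, hk₁⟩ := hTDI.exists_int_eq_min a hx₂ hmin
  have hvec : realVec (Pi.single s 1 + (N : ℤ) • a) =
      realVec (Pi.single s 1) + (N : ℝ) • realVec a := by
    ext t; simp [realVec]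
  obtain ⟨k₂, hk₂⟩ := hTDI.exists_int_eq_min (Pi.single s 1 + (N : ℤ) • a) hx₂ (by
    rw [hvec]; exact hN)
  have hone : realVec (Pi.single s 1 : n → ℤ) = Pi.single s 1 := by
    ext t; by_cases h : t = s <;> simp [realVec, h]
  have hxs : x₂ s = ((k₂ - N * k₁ : ℤ) : ℝ) := by
    rw [hvec, add_dotProduct, smul_dotProduct, smul_eq_mul, hk₁, hone, single_one_dotProduct]
      at hk₂
    push_cast
    linarith
  obtain ⟨h₂, hf₂, hg₂⟩ := (hmem x₂).1 hx₂
  have hfk : f s ≤ k₂ - N * k₁ := by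
    have := hf₂ s
    rw [hxs] at this
    exact_mod_cast this
  have hgk : k₂ - N * k₁ ≤ g s := by
    have := hg₂ s
    rw [hxs] at this
    exact_mod_cast this
  obtain ⟨v, hv, hfv, hvg, hav⟩ := ih _ (by
      rw [← hk]
      refine Finset.card_lt_card ⟨fun t ht => ?_, fun hsub => ?_⟩
      · by_cases h : t = s
        · subst h; simpa using hs
        · simpa [h] using ht
      · simpa using hsub (Finset.mem_filter.2 ⟨Finset.mem_univ s, hs⟩))
    (Function.update f s (k₂ - N * k₁)) (Function.update g s (k₂ - N * k₁)) h₂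
    (fun t => by
      by_cases h : t = s
      · subst h; simp [hxs]
      · simpa [h] using hf₂ t)
    (fun t => by
      by_cases h : t = s
      · subst h; simp [hxs]
      · simpa [h] using hg₂ t) rfl
  refine ⟨v, hv, fun t => (le_trans ?_ (hfv t)), fun t => (hvg t).trans ?_,
    hav.trans (hmin x hxP)⟩
  · by_cases h : t = s
    · subst h; simpa using hfk
    · simp [h]
  · by_cases h : t = s
    · subst h; simpa using hgk
    · simp [h]

end Box

/-! ### Necessity of the pair condition -/

theorem ExtLE.of_le_of_le {a : WithBot ℤ} {b : WithTop ℤ} {j k : ℤ} (ha : a ≤ WithBot.some j)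
    (hjk : j ≤ k) (hb : WithTop.some k ≤ b) : ExtLE a b := by
  cases a with
  | bot => exact extLE_bot b
  | coe a =>
    cases b with
    | top => exact extLE_top _
    | coe b =>
      exact (extLE_coe a b).2 ((WithBot.coe_le_coe.1 ha).trans (hjk.trans (WithTop.coe_le_coe.1 hb)))

/-- Minimality of `z` against the shifted point gives `w(Sm) ≤ w(Sp)`, and the bounds enclose these
two sums. -/
theorem pairCondition_of_isMinimizer {n : Type*} [Fintype n] [DecidableEq n] {R : Set (n → ℝ)}
    {z w : n → ℤ} {l : n → WithBot ℤ} {u : n → WithTop ℤ} (hw : IsBetween l u w)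
    (hmin : IsMinimizer R (realVec w) (realVec z)) : PairCondition R z l u := by
  intro Sm Sp _ hmem
  have hsum : ∀ X : Finset n, realVec w ⬝ᵥ charVec X = ((∑ s ∈ X, w s : ℤ) : ℝ) := fun X => by
    simp [dotProduct, charVec, realVec, Set.indicator_apply]
  have h := hmin.2 _ hmem
  rw [dotProduct_sub, dotProduct_add, hsum, hsum] at h
  have hle : ∑ s ∈ Sm, w s ≤ ∑ s ∈ Sp, w s := by
    have : ((∑ s ∈ Sm, w s : ℤ) : ℝ) ≤ ((∑ s ∈ Sp, w s : ℤ) : ℝ) := by linarith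
    exact_mod_cast this
  refine ExtLE.of_le_of_le (j := ∑ s ∈ Sm, w s) (k := ∑ s ∈ Sp, w s) ?_ hle ?_
  · rw [WithBot.coe_sum]
    exact Finset.sum_le_sum fun s _ => (hw s).1
  · rw [WithTop.coe_sum]
    exact Finset.sum_le_sum fun s _ => (hw s).2

/-! ### Rounding a real dual vector -/

/-- A point moving from a non-integer `r` towards an integer stays between the integers next to
`r` until it meets one of them. -/
theorem exists_first_integer_time (r : ℝ) (k : ℤ) (hr : ¬ ∃ j : ℤ, r = j) :
    ∃ t : ℝ, 0 < t ∧ t ≤ 1 ∧ (∃ j : ℤ, r + t * (k - r) = j) ∧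
      ∀ t', 0 ≤ t' → t' ≤ t → ∀ j : ℤ, ((j : ℝ) ≤ r → (j : ℝ) ≤ r + t' * (k - r)) ∧
        (r ≤ j → r + t' * (k - r) ≤ j) := by
  have hfl : (⌊r⌋ : ℝ) < r := lt_of_le_of_ne (Int.floor_le r) fun h => hr ⟨_, h.symm⟩
  have hce : r < (⌈r⌉ : ℝ) := lt_of_le_of_ne (Int.le_ceil r) fun h => hr ⟨_, h⟩
  rcases lt_or_ge r k with hk | hk
  · have hck : (⌈r⌉ : ℝ) ≤ k := by exact_mod_cast Int.ceil_le.2 hk.le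
    have hpos : 0 < (k : ℝ) - r := sub_pos.2 hk
    have heq : (⌈r⌉ - r) / (k - r) * (k - r) = ⌈r⌉ - r := div_mul_cancel₀ _ hpos.ne'
    refine ⟨(⌈r⌉ - r) / (k - r), div_pos (sub_pos.2 hce) hpos,
      (div_le_one hpos).2 (by linarith), ⟨⌈r⌉, by linarith⟩, fun t' h0 h1 j =>
        ⟨fun hj => ?_, fun hj => ?_⟩⟩
    · linarith [mul_nonneg h0 hpos.le]
    · have h2 := mul_le_mul_of_nonneg_right h1 hpos.le
      have h3 : (⌈r⌉ : ℝ) ≤ j := by exact_mod_cast Int.ceil_le.2 hj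
      linarith
  · have hkr : (k : ℝ) < r := lt_of_le_of_ne hk fun h => hr ⟨_, h.symm⟩
    have hck : (k : ℝ) ≤ ⌊r⌋ := by exact_mod_cast Int.le_floor.2 hkr.le
    have hpos : 0 < r - (k : ℝ) := sub_pos.2 hkr
    have heq : (r - ⌊r⌋) / (r - k) * (r - k) = r - ⌊r⌋ := div_mul_cancel₀ _ hpos.ne'
    refine ⟨(r - ⌊r⌋) / (r - k), div_pos (sub_pos.2 hfl) hpos,
      (div_le_one hpos).2 (by linarith), ⟨⌊r⌋, by linarith⟩, fun t' h0 h1 j =>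
        ⟨fun hj => ?_, fun hj => ?_⟩⟩
    · have h2 := mul_le_mul_of_nonneg_right h1 hpos.le
      have h3 : (j : ℝ) ≤ ⌊r⌋ := by exact_mod_cast Int.le_floor.2 hj
      linarith
    · linarith [mul_nonneg h0 hpos.le]

section Rounding

variable {m S : Type*} [Fintype S]

theorem mem_polyhedron_ratMatrix {Q : Matrix m S ℤ} {p : m → ℤ} {x : S → ℝ} :
    x ∈ polyhedron (ratMatrix Q) (ratVec p) ↔
      ∀ i, (p i : ℝ) ≤ (Q.map (Int.cast : ℤ → ℝ) *ᵥ x) i := by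
  simp [polyhedron, ratMatrix, ratVec, Function.comp_def]

theorem map_mulVec_realVec (Q : Matrix m S ℤ) (z : S → ℤ) (i : m) :
    (Q.map (Int.cast : ℤ → ℝ) *ᵥ realVec z) i = ((Q *ᵥ z) i : ℤ) := by
  simp [Matrix.mulVec, dotProduct, realVec]

variable [Fintype m] [DecidableEq S]

/-- An integral dual vector whose combination `y Q` takes prescribed integral values, wherever a
real dual vector takes these values. -/
theorem IsBoxTDI.exists_int_dual_eqOn {Q : Matrix m S ℤ} {p : m → ℤ}
    (hQ : IsBoxTDI (ratMatrix Q) (ratVec p)) {z : S → ℤ}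
    (hz : realVec z ∈ polyhedron (ratMatrix Q) (ratVec p)) {y : m → ℝ} (hy : ∀ i, 0 ≤ y i)
    (hyz : y ⬝ᵥ realVec (Q *ᵥ z - p) = 0) (T : Finset S) (c : S → ℤ)
    (hc : ∀ s ∈ T, (y ᵥ* Q.map (Int.cast : ℤ → ℝ)) s = c s) :
    ∃ y' : m → ℤ, (∀ i, 0 ≤ y' i) ∧ y' ⬝ᵥ (Q *ᵥ z - p) = 0 ∧ ∀ s ∈ T, (y' ᵥ* Q) s = c s := by
  -- The box frees exactly the coordinates in `T` and pins the others to `z`; on `T`, `z` lies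
  -- strictly inside.
  let χ : S → ℤ := fun s => if s ∈ T then 1 else 0
  have hχ0 : ∀ s, 0 ≤ χ s := fun s => by by_cases h : s ∈ T <;> simp [χ, h]
  have hTDI := hQ (ratVec (z - χ)) (ratVec (z + χ)) fun s => by
    have := hχ0 s
    simp only [ratVec, Pi.sub_apply, Pi.add_apply]
    exact_mod_cast (by omega : z s - χ s ≤ z s + χ s)
  have hmem : ∀ x : S → ℝ, x ∈ polyhedron (boxMatrix (ratMatrix Q)) (boxRhs (ratVec p)
      (ratVec (z - χ)) (ratVec (z + χ))) ↔ x ∈ polyhedron (ratMatrix Q) (ratVec p) ∧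
      (∀ s, (z s : ℝ) - χ s ≤ x s) ∧ ∀ s, x s ≤ z s + χ s := fun x => by
    rw [mem_polyhedron_box]; simp [ratVec]
  have hzP := (hmem (realVec z)).2 ⟨hz, fun s => by
    have : (0 : ℝ) ≤ χ s := by exact_mod_cast hχ0 s
    simp only [realVec]; linarith, fun s => by
    have : (0 : ℝ) ≤ χ s := by exact_mod_cast hχ0 s
    simp only [realVec]; linarith⟩
  obtain ⟨y', ⟨hy'0, hy'c⟩, hobj⟩ := hTDI.exists_int_dual c hzP fun x hx => by
    obtain ⟨hxP, hf, hg⟩ := (hmem x).1 hx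
    rw [mem_polyhedron_ratMatrix] at hxP
    have h1 : (y ᵥ* Q.map (Int.cast : ℤ → ℝ)) ⬝ᵥ realVec z ≤
        (y ᵥ* Q.map (Int.cast : ℤ → ℝ)) ⬝ᵥ x := by
      rw [← Matrix.dotProduct_mulVec, ← Matrix.dotProduct_mulVec]
      have h2 : y ⬝ᵥ (Q.map (Int.cast : ℤ → ℝ) *ᵥ realVec z) = y ⬝ᵥ realVec p := by
        have h3 : Q.map (Int.cast : ℤ → ℝ) *ᵥ realVec z = realVec (Q *ᵥ z - p) + realVec p := by
          ext i
          rw [map_mulVec_realVec]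
          simp [realVec]
        rw [h3, dotProduct_add, hyz, zero_add]
      rw [h2]
      exact Finset.sum_le_sum fun i _ => mul_le_mul_of_nonneg_left (hxP i) (hy i)
    -- `c` and `yQ` can differ only off `T`, where `x = z`; so `z` minimizes `c` over the box.
    have h4 : realVec c ⬝ᵥ x - realVec c ⬝ᵥ realVec z =
        (y ᵥ* Q.map (Int.cast : ℤ → ℝ)) ⬝ᵥ x -
          (y ᵥ* Q.map (Int.cast : ℤ → ℝ)) ⬝ᵥ realVec z := by
      rw [← dotProduct_sub, ← dotProduct_sub]
      refine Finset.sum_congr rfl fun s _ => ?_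
      by_cases hs : s ∈ T
      · rw [hc s hs]; rfl
      · have hf := hf s
        have hg := hg s
        simp only [χ, hs, if_false, Int.cast_zero, sub_zero, add_zero] at hf hg
        have : (x - realVec z) s = 0 := by
          simp only [Pi.sub_apply, realVec]; linarith
        rw [this, mul_zero, mul_zero]
    linarith
  have hy'n : ∀ i, 0 ≤ y' i := fun i => Int.cast_nonneg_iff.1 (hy'0 i)
  have hcol : ∀ s, ((fun i => y' (Sum.inl i)) ᵥ* Q) s + y' (Sum.inr (Sum.inl s)) -
      y' (Sum.inr (Sum.inr s)) = c s := fun s => by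
    have := congrFun hy'c s
    simp only [Matrix.vecMul, dotProduct, Fintype.sum_sum_type, boxMatrix, Matrix.map_apply,
      Matrix.fromRows_apply_inl, Matrix.fromRows_apply_inr, Matrix.one_apply, Matrix.neg_apply,
      realVec, ratMatrix, apply_ite (Rat.cast : ℚ → ℝ), Rat.cast_neg, Rat.cast_one, Rat.cast_zero,
      Rat.cast_intCast, mul_ite, mul_one, mul_zero, mul_neg, Finset.sum_neg_distrib,
      Finset.sum_ite_eq', Finset.mem_univ, if_true] at this
    simp only [Matrix.vecMul, dotProduct]
    have h : ((∑ i, y' (Sum.inl i) * Q i s + y' (Sum.inr (Sum.inl s)) -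
      y' (Sum.inr (Sum.inr s)) : ℤ) : ℝ) = c s := by
      push_cast
      linarith
    exact_mod_cast h
  have hval : ∑ i, y' (Sum.inl i) * p i + (∑ s, y' (Sum.inr (Sum.inl s)) * (z s - χ s) -
      ∑ s, y' (Sum.inr (Sum.inr s)) * (z s + χ s)) = ∑ s, c s * z s := by
    simp only [dualObjective, dotProduct, Fintype.sum_sum_type, boxRhs, Sum.elim_inl,
      Sum.elim_inr, realVec, ratVec, Pi.neg_apply, Rat.cast_neg, Rat.cast_intCast, mul_neg,
      Finset.sum_neg_distrib, ← sub_eq_add_neg, Pi.sub_apply, Pi.add_apply] at hobj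
    exact_mod_cast hobj
  have hslack : ∀ i, 0 ≤ (Q *ᵥ z - p) i := fun i => by
    have := mem_polyhedron_ratMatrix.1 hz i
    rw [map_mulVec_realVec] at this
    have : p i ≤ (Q *ᵥ z) i := by exact_mod_cast this
    simpa using this
  have hA : (fun i => y' (Sum.inl i)) ⬝ᵥ (Q *ᵥ z - p) =
      ∑ s, ((fun i => y' (Sum.inl i)) ᵥ* Q) s * z s - ∑ i, y' (Sum.inl i) * p i := by
    rw [dotProduct_sub, Matrix.dotProduct_mulVec]; rfl
  have hB : ∑ s, c s * z s = ∑ s, ((fun i => y' (Sum.inl i)) ᵥ* Q) s * z s +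
      ∑ s, y' (Sum.inr (Sum.inl s)) * z s - ∑ s, y' (Sum.inr (Sum.inr s)) * z s := by
    rw [← Finset.sum_add_distrib, ← Finset.sum_sub_distrib]
    exact Finset.sum_congr rfl fun s _ => by rw [← hcol s]; ring
  -- Complementary slackness: by `hval` and `hB` the three nonnegative sums in `h1`, `h2`, `h3` add
  -- up to zero. Hence the box multipliers vanish on `T`.
  have h1 : 0 ≤ (fun i => y' (Sum.inl i)) ⬝ᵥ (Q *ᵥ z - p) :=
    Finset.sum_nonneg fun i _ => mul_nonneg (hy'n _) (hslack i)
  have h2 : ∀ s ∈ Finset.univ, 0 ≤ y' (Sum.inr (Sum.inl s)) * χ s := fun s _ =>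
    mul_nonneg (hy'n _) (hχ0 s)
  have h3 : ∀ s ∈ Finset.univ, 0 ≤ y' (Sum.inr (Sum.inr s)) * χ s := fun s _ =>
    mul_nonneg (hy'n _) (hχ0 s)
  simp only [mul_sub, mul_add, Finset.sum_sub_distrib, Finset.sum_add_distrib] at hval
  have h2' := Finset.sum_nonneg h2
  have h3' := Finset.sum_nonneg h3
  refine ⟨fun i => y' (Sum.inl i), fun i => hy'n _, by linarith, fun s hs => ?_⟩
  have h4 := (Finset.sum_eq_zero_iff_of_nonneg h2).1 (by linarith) s (Finset.mem_univ s)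
  have h5 := (Finset.sum_eq_zero_iff_of_nonneg h3).1 (by linarith) s (Finset.mem_univ s)
  simp only [χ, hs, if_true, mul_one] at h4 h5
  have := hcol s
  linarith

/-- Rounding of dual solutions: integral bounds on `y Q` that hold for some real dual vector
hold for an integral one. -/
theorem IsBoxTDI.exists_int_dual_of_real {Q : Matrix m S ℤ} {p : m → ℤ}
    (hQ : IsBoxTDI (ratMatrix Q) (ratVec p)) {z : S → ℤ}
    (hz : realVec z ∈ polyhedron (ratMatrix Q) (ratVec p)) (L U : S → Set ℤ) {y : m → ℝ}
    (hy : ∀ i, 0 ≤ y i) (hyz : y ⬝ᵥ realVec (Q *ᵥ z - p) = 0)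
    (hL : ∀ s, ∀ k ∈ L s, (k : ℝ) ≤ (y ᵥ* Q.map (Int.cast : ℤ → ℝ)) s)
    (hU : ∀ s, ∀ k ∈ U s, (y ᵥ* Q.map (Int.cast : ℤ → ℝ)) s ≤ k) :
    ∃ y' : m → ℤ, (∀ i, 0 ≤ y' i) ∧ y' ⬝ᵥ (Q *ᵥ z - p) = 0 ∧
      (∀ s, ∀ k ∈ L s, k ≤ (y' ᵥ* Q) s) ∧ ∀ s, ∀ k ∈ U s, (y' ᵥ* Q) s ≤ k := by
  classical
  induction hk : (Finset.univ.filter fun s =>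
      ¬ ∃ j : ℤ, (y ᵥ* Q.map (Int.cast : ℤ → ℝ)) s = j).card using Nat.strong_induction_on
    generalizing y with
  | _ k ih =>
  set w := y ᵥ* Q.map (Int.cast : ℤ → ℝ) with hw
  -- The floor merely names the integral values; elsewhere it is an arbitrary choice.
  obtain ⟨y', hy', hy'z, hy'c⟩ := hQ.exists_int_dual_eqOn hz hy hyz
    (Finset.univ.filter fun s => ∃ j : ℤ, w s = j) (fun s => ⌊w s⌋) (fun s hs => by
      obtain ⟨j, hj⟩ := (Finset.mem_filter.1 hs).2
      rw [← hw, hj, Int.floor_intCast])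
  have hint : ∀ s, (∃ j : ℤ, w s = j) → w s = ((y' ᵥ* Q) s : ℤ) := fun s hs => by
    rw [hy'c s (by simpa using hs)]
    obtain ⟨j, hj⟩ := hs
    rw [hj, Int.floor_intCast]
  by_cases hall : ∀ s, ∃ j : ℤ, w s = j
  · refine ⟨y', hy', hy'z, fun s j hj => ?_, fun s j hj => ?_⟩
    · have := hL s j hj
      rw [hint s (hall s)] at this
      exact_mod_cast this
    · have := hU s j hj
      rw [hint s (hall s)] at this
      exact_mod_cast this
  push Not at hall
  obtain ⟨s₀, hs₀⟩ := hall
  have ht : ∀ s, ∃ t : ℝ, (¬ ∃ j : ℤ, w s = j) → (0 < t ∧ t ≤ 1 ∧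
      (∃ j : ℤ, w s + t * (((y' ᵥ* Q) s : ℤ) - w s) = j) ∧
      ∀ t', 0 ≤ t' → t' ≤ t → ∀ j : ℤ,
        ((j : ℝ) ≤ w s → (j : ℝ) ≤ w s + t' * (((y' ᵥ* Q) s : ℤ) - w s)) ∧
        (w s ≤ j → w s + t' * (((y' ᵥ* Q) s : ℤ) - w s) ≤ j)) := fun s => by
    by_cases h : ∃ j : ℤ, w s = j
    · exact ⟨0, fun h' => absurd h h'⟩
    · obtain ⟨t, ht⟩ := exists_first_integer_time (w s) ((y' ᵥ* Q) s) h
      exact ⟨t, fun _ => ht⟩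
  choose t ht using ht
  -- At the least stopping time, coordinate `s` becomes integral, no other fractional coordinate has
  -- passed an integer, and integral ones do not move.
  obtain ⟨s, hs, hmin⟩ := (Finset.univ.filter fun s => ¬ ∃ j : ℤ, w s = j).exists_min_image t
    ⟨s₀, by simpa using hs₀⟩
  obtain ⟨ht0, ht1, hts, -⟩ := ht s (Finset.mem_filter.1 hs).2
  have hreal : (realVec y') ᵥ* Q.map (Int.cast : ℤ → ℝ) = realVec (y' ᵥ* Q) := by
    ext a; simp [Matrix.vecMul, dotProduct, realVec]
  have hw' : ∀ a, ((y + t s • (realVec y' - y)) ᵥ* Q.map (Int.cast : ℤ → ℝ)) a =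
      w a + t s * (((y' ᵥ* Q) a : ℤ) - w a) := fun a => by
    rw [Matrix.add_vecMul, Matrix.smul_vecMul, Matrix.sub_vecMul, hreal]
    rfl
  have hfix : ∀ a, (∃ j : ℤ, w a = j) → w a + t s * (((y' ᵥ* Q) a : ℤ) - w a) = w a :=
    fun a ha => by rw [← hint a ha]; ring
  have hbd : ∀ a, ∀ j : ℤ, ((j : ℝ) ≤ w a → (j : ℝ) ≤ w a + t s * (((y' ᵥ* Q) a : ℤ) - w a)) ∧
      (w a ≤ j → w a + t s * (((y' ᵥ* Q) a : ℤ) - w a) ≤ j) := fun a j => by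
    by_cases ha : ∃ j : ℤ, w a = j
    · rw [hfix a ha]; exact ⟨id, id⟩
    · exact (ht a ha).2.2.2 (t s) ht0.le (hmin a (by simpa using ha)) j
  refine ih _ ?_ (y := y + t s • (realVec y' - y)) (fun i => ?_) ?_ (fun a j hj => ?_)
    (fun a j hj => ?_) rfl
  · rw [← hk]
    refine Finset.card_lt_card ⟨fun a ha => ?_, fun hsub => ?_⟩
    · refine Finset.mem_filter.2 ⟨Finset.mem_univ a, fun h => (Finset.mem_filter.1 ha).2 ?_⟩
      rw [hw', hfix a h]
      exact h
    · refine (Finset.mem_filter.1 (hsub hs)).2 ?_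
      rw [hw']
      exact hts
  · have h1 : (0 : ℝ) ≤ y' i := by exact_mod_cast hy' i
    have h2 : (y + t s • (realVec y' - y)) i = (1 - t s) * y i + t s * y' i := by
      simp only [Pi.add_apply, Pi.smul_apply, Pi.sub_apply, smul_eq_mul, realVec]; ring
    rw [h2]
    exact add_nonneg (mul_nonneg (sub_nonneg.2 ht1) (hy i)) (mul_nonneg ht0.le h1)
  · have : realVec y' ⬝ᵥ realVec (Q *ᵥ z - p) = 0 := by
      have h : realVec y' ⬝ᵥ realVec (Q *ᵥ z - p) = ((y' ⬝ᵥ (Q *ᵥ z - p) : ℤ) : ℝ) := by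
        simp [dotProduct, realVec]
      rw [h, hy'z, Int.cast_zero]
    rw [add_dotProduct, smul_dotProduct, sub_dotProduct, hyz, this]
    simp
  · rw [hw']
    exact (hbd a j).1 (hL a j hj)
  · rw [hw']
    exact (hbd a j).2 (hU a j hj)

end Rounding

/-! ### Sufficiency: a real dual vector -/

/-- Puts an integral point of the unit box around `z` into the form tested by `PairCondition`. -/
theorem charVec_filter_sub {S : Type*} [Fintype S] (z v : S → ℤ)
    (h : ∀ s, z s - 1 ≤ v s ∧ v s ≤ z s + 1) :
    realVec z + charVec (Finset.univ.filter fun s => z s < v s) -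
      charVec (Finset.univ.filter fun s => v s < z s) = realVec v := by
  ext s
  obtain ⟨h1, h2⟩ := h s
  simp only [realVec, charVec, Pi.add_apply, Pi.sub_apply, Set.indicator_apply,
    Finset.coe_filter_univ, Set.mem_ofPred_eq, Pi.one_apply]
  rcases lt_trichotomy (v s) (z s) with h | h | h
  · have : v s = z s - 1 := by omega
    simp [this]
  · simp [h]
  · have : v s = z s + 1 := by omega
    simp [this]

variable {m S : Type*} [Fintype m] [Fintype S]

/-- A small step from `z` in a direction `d` that no constraint active at `z` forbids stays in the
polyhedron and in the unit box around `z`. -/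
theorem exists_feasible_step {Q : Matrix m S ℤ} {p : m → ℤ} {z : S → ℤ}
    (hz : realVec z ∈ polyhedron (ratMatrix Q) (ratVec p)) (d : S → ℝ)
    (hd : ∀ i, (Q *ᵥ z) i = p i → 0 ≤ (Q.map (Int.cast : ℤ → ℝ) *ᵥ d) i) :
    ∃ ε : ℝ, 0 < ε ∧ realVec z + ε • d ∈ polyhedron (ratMatrix Q) (ratVec p) ∧
      ∀ s, |ε * d s| ≤ 1 := by
  have hcont : ∀ c e b : ℝ, c < b → ∀ᶠ ε in nhdsWithin (0 : ℝ) (Set.Ioi 0), c + ε * e < b :=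
    fun c e b h => by
      have : Filter.Tendsto (fun ε : ℝ => c + ε * e) (nhds 0) (nhds (c + 0 * e)) :=
        Continuous.tendsto (by fun_prop) 0
      rw [zero_mul, add_zero] at this
      exact (this.eventually (gt_mem_nhds h)).filter_mono nhdsWithin_le_nhds
  have h1 : ∀ᶠ ε in nhdsWithin (0 : ℝ) (Set.Ioi 0), ∀ s, ε * d s < 1 ∧ ε * -d s < 1 :=
    Filter.eventually_all.2 fun s => by
      filter_upwards [hcont 0 (d s) 1 one_pos, hcont 0 (-d s) 1 one_pos] with ε h1 h2
      rw [zero_add] at h1 h2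
      exact ⟨h1, h2⟩
  rw [mem_polyhedron_ratMatrix] at hz
  have h2 : ∀ᶠ ε in nhdsWithin (0 : ℝ) (Set.Ioi 0), ∀ i,
      (p i : ℝ) ≤ (Q.map (Int.cast : ℤ → ℝ) *ᵥ (realVec z + ε • d)) i :=
    Filter.eventually_all.2 fun i => by
      simp only [Matrix.mulVec_add, Matrix.mulVec_smul, Pi.add_apply, Pi.smul_apply, smul_eq_mul]
      by_cases hi : (Q *ᵥ z) i = p i
      · filter_upwards [self_mem_nhdsWithin] with ε hε
        linarith [hz i, mul_nonneg (le_of_lt (Set.mem_Ioi.1 hε)) (hd i hi)]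
      · have hlt : (p i : ℝ) < (Q.map (Int.cast : ℤ → ℝ) *ᵥ realVec z) i := by
          refine lt_of_le_of_ne (hz i) fun h => hi ?_
          rw [map_mulVec_realVec] at h
          exact_mod_cast h.symm
        filter_upwards [hcont (-(Q.map (Int.cast : ℤ → ℝ) *ᵥ realVec z) i)
          (-(Q.map (Int.cast : ℤ → ℝ) *ᵥ d) i) (-p i) (neg_lt_neg hlt)] with ε hε
        linarith
  obtain ⟨ε, ⟨h1, h2⟩, hε⟩ := ((h1.and h2).and self_mem_nhdsWithin).exists
  exact ⟨ε, hε, mem_polyhedron_ratMatrix.2 h2, fun s =>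
    abs_le.2 ⟨by linarith [(h1 s).2], (h1 s).1.le⟩⟩

/-- Weak duality, with equality at `z` by complementary slackness. -/
theorem isMinimizer_of_dual {Q : Matrix m S ℤ} {p : m → ℤ} {z : S → ℤ}
    (hz : realVec z ∈ polyhedron (ratMatrix Q) (ratVec p)) {y : m → ℤ} (hy : ∀ i, 0 ≤ y i)
    (hyz : y ⬝ᵥ (Q *ᵥ z - p) = 0) :
    IsMinimizer (polyhedron (ratMatrix Q) (ratVec p)) (realVec (y ᵥ* Q)) (realVec z) := by
  refine ⟨hz, fun x hx => ?_⟩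
  rw [mem_polyhedron_ratMatrix] at hx
  have hreal : realVec (y ᵥ* Q) = realVec y ᵥ* Q.map (Int.cast : ℤ → ℝ) := by
    ext a; simp [Matrix.vecMul, dotProduct, realVec]
  have hval : realVec (y ᵥ* Q) ⬝ᵥ realVec z = realVec y ⬝ᵥ realVec p := by
    have h1 : realVec (y ᵥ* Q) ⬝ᵥ realVec z = (((y ᵥ* Q) ⬝ᵥ z : ℤ) : ℝ) := by
      simp [dotProduct, realVec]
    have h2 : realVec y ⬝ᵥ realVec p = ((y ⬝ᵥ p : ℤ) : ℝ) := by
      simp [dotProduct, realVec]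
    rw [dotProduct_sub, Matrix.dotProduct_mulVec, sub_eq_zero] at hyz
    rw [h1, h2, hyz]
  rw [hval, hreal, ← Matrix.dotProduct_mulVec]
  exact Finset.sum_le_sum fun i _ =>
    mul_le_mul_of_nonneg_left (hx i) (Int.cast_nonneg_iff.2 (hy i))

variable [DecidableEq S]

/-- The pair condition makes every direction feasible at `z` have nonnegative cost, where
increasing `s` costs `u s` and decreasing it costs `-l s`. -/
theorem IsBoxTDI.cost_nonneg {Q : Matrix m S ℤ} {p : m → ℤ}
    (hQ : IsBoxTDI (ratMatrix Q) (ratVec p)) {z : S → ℤ}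
    (hz : realVec z ∈ polyhedron (ratMatrix Q) (ratVec p)) {l : S → WithBot ℤ} {u : S → WithTop ℤ}
    (hcond : PairCondition (polyhedron (ratMatrix Q) (ratVec p)) z l u) (a : S → ℤ) (d : S → ℝ)
    (hd : ∀ i, (Q *ᵥ z) i = p i → 0 ≤ (Q.map (Int.cast : ℤ → ℝ) *ᵥ d) i)
    (hneg : ∀ s, d s < 0 → l s = WithBot.some (a s))
    (hpos : ∀ s, 0 < d s → u s = WithTop.some (a s)) : 0 ≤ realVec a ⬝ᵥ d := by
  classical
  obtain ⟨ε, hε, hmem, hε1⟩ := exists_feasible_step hz d hd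
  -- This box lets `v` move from `z` by at most one, and only in the sign of `d`, so that `a` is `l`
  -- on each decrease and `u` on each increase.
  obtain ⟨v, hv, hfv, hvg, hav⟩ := hQ.exists_int_le a
    (fun s => z s - if d s < 0 then 1 else 0) (fun s => z s + if 0 < d s then 1 else 0) hmem
    (fun s => by
      have := (abs_le.1 (hε1 s)).1
      simp only [Pi.add_apply, Pi.smul_apply, smul_eq_mul, realVec]
      split_ifs with h
      · push_cast; linarith
      · have := mul_nonneg hε.le (not_lt.1 h)
        push_cast; linarith)
    (fun s => by
      have := (abs_le.1 (hε1 s)).2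
      simp only [Pi.add_apply, Pi.smul_apply, smul_eq_mul, realVec]
      split_ifs with h
      · push_cast; linarith
      · have := mul_nonpos_of_nonneg_of_nonpos hε.le (not_lt.1 h)
        push_cast; linarith)
  have hf : ∀ s, z s - 1 ≤ v s ∧ (v s < z s → d s < 0) := fun s => by
    have := hfv s
    simp only at this
    split_ifs at this with h
    · exact ⟨this, fun _ => h⟩
    · exact ⟨by omega, fun _ => by omega⟩
  have hg : ∀ s, v s ≤ z s + 1 ∧ (z s < v s → 0 < d s) := fun s => by
    have := hvg s
    simp only at this
    split_ifs at this with h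
    · exact ⟨this, fun _ => h⟩
    · exact ⟨by omega, fun _ => by omega⟩
  have hext := hcond (Finset.univ.filter fun s => v s < z s)
    (Finset.univ.filter fun s => z s < v s)
    (Finset.disjoint_filter.2 fun s _ h1 h2 => lt_asymm h1 h2)
    (by rw [charVec_filter_sub z v fun s => ⟨(hf s).1, (hg s).1⟩]; exact hv)
  rw [Finset.sum_congr rfl fun s hs => hneg s ((hf s).2 (Finset.mem_filter.1 hs).2),
    Finset.sum_congr rfl fun s hs => hpos s ((hg s).2 (Finset.mem_filter.1 hs).2),
    ← WithBot.coe_sum, ← WithTop.coe_sum] at hext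
  have hle := (extLE_coe _ _).1 hext
  have hsum : a ⬝ᵥ (v - z) = ∑ s with z s < v s, a s - ∑ s with v s < z s, a s := by
    rw [Finset.sum_filter, Finset.sum_filter, ← Finset.sum_sub_distrib]
    refine Finset.sum_congr rfl fun s _ => ?_
    obtain ⟨h1, -⟩ := hf s
    obtain ⟨h2, -⟩ := hg s
    rcases lt_trichotomy (v s) (z s) with h | h | h
    · have : v s = z s - 1 := by omega
      simp [this, show ¬ z s < z s - 1 by omega]
    · simp [h]
    · have : v s = z s + 1 := by omega
      simp [this]
  have hcast : realVec a ⬝ᵥ realVec v - realVec a ⬝ᵥ realVec z = ((a ⬝ᵥ (v - z) : ℤ) : ℝ) := by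
    rw [← dotProduct_sub]; simp [dotProduct, realVec]
  have h0 : (0 : ℝ) ≤ ((a ⬝ᵥ (v - z) : ℤ) : ℝ) := by
    rw [hsum]; exact_mod_cast sub_nonneg.2 hle
  rw [dotProduct_add, dotProduct_smul, smul_eq_mul] at hav
  by_contra hcontra
  have := mul_neg_of_pos_of_neg hε (not_le.1 hcontra)
  linarith

/-- Under the pair condition, some real dual vector complementary to `z` satisfies the bounds. -/
theorem IsBoxTDI.exists_real_dual {Q : Matrix m S ℤ} {p : m → ℤ}
    (hQ : IsBoxTDI (ratMatrix Q) (ratVec p)) {z : S → ℤ}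
    (hz : realVec z ∈ polyhedron (ratMatrix Q) (ratVec p)) {l : S → WithBot ℤ} {u : S → WithTop ℤ}
    (hlu : ∀ s, ExtLE (l s) (u s))
    (hcond : PairCondition (polyhedron (ratMatrix Q) (ratVec p)) z l u) :
    ∃ y : m → ℝ, (∀ i, 0 ≤ y i) ∧ y ⬝ᵥ realVec (Q *ᵥ z - p) = 0 ∧
      (∀ s, ∀ k : ℤ, l s = WithBot.some k → (k : ℝ) ≤ (y ᵥ* Q.map (Int.cast : ℤ → ℝ)) s) ∧
      ∀ s, ∀ k : ℤ, u s = WithTop.some k → (y ᵥ* Q.map (Int.cast : ℤ → ℝ)) s ≤ k := by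
  classical
  -- Zeroing the rows slack at `z` replaces complementarity: a solution can afterwards be set to
  -- zero on those rows.
  let Q' : Matrix m S ℝ := Matrix.of fun i s => if (Q *ᵥ z) i = p i then (Q i s : ℝ) else 0
  -- An infinite bound becomes the vacuous row `0 ≤ 0`, thanks to the default value `0` in `r`.
  let B : Matrix (m ⊕ S ⊕ S) m ℝ := Matrix.fromRows 1 (Matrix.fromRows
    (Matrix.of fun s i => if l s = ⊥ then 0 else Q' i s)
    (Matrix.of fun s i => if u s = ⊤ then 0 else -Q' i s))
  let r : m ⊕ S ⊕ S → ℝ := Sum.elim 0 (Sum.elim (fun s => ((l s).unbotD 0 : ℤ))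
    (fun s => -((u s).untopD 0 : ℤ)))
  by_cases hfeas : ∃ y, ∀ i, r i ≤ (B *ᵥ y) i
  · obtain ⟨y, hy⟩ := hfeas
    have hQ' : (fun i => if (Q *ᵥ z) i = p i then y i else 0) ᵥ* Q.map (Int.cast : ℤ → ℝ) =
        y ᵥ* Q' := by
      ext s
      refine Finset.sum_congr rfl fun i _ => ?_
      by_cases h : (Q *ᵥ z) i = p i <;> simp [Q', h]
    refine ⟨fun i => if (Q *ᵥ z) i = p i then y i else 0, fun i => ?_, ?_, ?_⟩
    · have := hy (Sum.inl i)
      simp only [r, B, Sum.elim_inl, Matrix.fromRows_mulVec, Matrix.one_mulVec] at this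
      dsimp only
      split_ifs
      · exact this
      · exact le_rfl
    · refine Finset.sum_eq_zero fun i _ => ?_
      by_cases h : (Q *ᵥ z) i = p i <;> simp [h, realVec]
    · rw [hQ']
      refine ⟨fun s k hk => ?_, fun s k hk => ?_⟩
      · have := hy (Sum.inr (Sum.inl s))
        simp only [r, B, Sum.elim_inr, Sum.elim_inl, Matrix.mulVec, dotProduct,
          Matrix.fromRows_apply_inr, Matrix.fromRows_apply_inl, Matrix.of_apply, hk,
          WithBot.coe_ne_bot, if_false, WithBot.unbotD_coe] at this
        rw [Matrix.vecMul, dotProduct_comm]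
        exact this
      · have := hy (Sum.inr (Sum.inr s))
        simp only [r, B, Sum.elim_inr, Matrix.mulVec, dotProduct,
          Matrix.fromRows_apply_inr, Matrix.of_apply, hk,
          WithTop.coe_ne_top, if_false, WithTop.untopD_coe, neg_mul, Finset.sum_neg_distrib,
          neg_le_neg_iff] at this
        rw [Matrix.vecMul, dotProduct_comm]
        exact this
  · obtain ⟨q, hq, hqB, hqr⟩ := exists_infeasibility_certificate B r hfeas
    let ql : S → ℝ := fun s => if l s = ⊥ then 0 else q (Sum.inr (Sum.inl s))
    let qu : S → ℝ := fun s => if u s = ⊤ then 0 else q (Sum.inr (Sum.inr s))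
    have hql : ∀ s, 0 ≤ ql s := fun s => by simp only [ql]; split_ifs <;> simp [hq]
    have hqu : ∀ s, 0 ≤ qu s := fun s => by simp only [qu]; split_ifs <;> simp [hq]
    -- The certificate read by columns: `qu - ql` is a direction that the tight rows allow.
    have hrow : ∀ i, (Q' *ᵥ (qu - ql)) i = q (Sum.inl i) := fun i => by
      have := congrFun hqB i
      simp only [B, Matrix.vecMul, dotProduct, Fintype.sum_sum_type, Matrix.fromRows_apply_inl,
        Matrix.fromRows_apply_inr, Matrix.one_apply, Matrix.of_apply, mul_ite, mul_one, mul_zero,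
        Finset.sum_ite_eq', Finset.mem_univ, if_true, Pi.zero_apply] at this
      rw [Matrix.mulVec_sub, Pi.sub_apply]
      have h1 : (Q' *ᵥ ql) i = ∑ s, if l s = ⊥ then 0 else q (Sum.inr (Sum.inl s)) * Q' i s :=
        Finset.sum_congr rfl fun s _ => by simp only [ql]; split_ifs <;> ring
      have h2 : (Q' *ᵥ qu) i =
          -∑ s, if u s = ⊤ then 0 else q (Sum.inr (Sum.inr s)) * -Q' i s := by
        rw [← Finset.sum_neg_distrib]
        exact Finset.sum_congr rfl fun s _ => by simp only [qu]; split_ifs <;> ring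
      rw [h1, h2]
      linarith
    let a : S → ℤ := fun s => if ql s < qu s then (u s).untopD 0 else (l s).unbotD 0
    have hcost := hQ.cost_nonneg hz hcond a (qu - ql) (fun i hi => by
        have h1 := hrow i
        have h2 : (Q' *ᵥ (qu - ql)) i = (Q.map (Int.cast : ℤ → ℝ) *ᵥ (qu - ql)) i :=
          Finset.sum_congr rfl fun s _ => by simp [Q', hi]
        rw [← h2, h1]
        exact hq _)
      (fun s hs => by
        have hs' : qu s < ql s := by simpa using hs
        have hl : l s ≠ ⊥ := fun h => by
          have : ql s = 0 := by simp [ql, h]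
          linarith [hqu s]
        obtain ⟨k, hk⟩ := WithBot.ne_bot_iff_exists.1 hl
        simp only [a, if_neg (not_lt.2 hs'.le), ← hk, WithBot.unbotD_coe])
      (fun s hs => by
        have hs' : ql s < qu s := by simpa using hs
        have hu : u s ≠ ⊤ := fun h => by
          have : qu s = 0 := by simp [qu, h]
          linarith [hql s]
        obtain ⟨k, hk⟩ := WithTop.ne_top_iff_exists.1 hu
        simp only [a, if_pos hs', ← hk, WithTop.untopD_coe])
    -- For finite bounds the gap is `(u s - l s) * ql s` or `(u s - l s) * qu s`, nonnegative since
    -- `l ≤ u`.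
    have hterm : ∀ s, realVec a s * (qu - ql) s ≤
        ((u s).untopD 0 : ℤ) * q (Sum.inr (Sum.inr s)) -
          ((l s).unbotD 0 : ℤ) * q (Sum.inr (Sum.inl s)) := fun s => by
      have h1 := hql s
      have h2 := hqu s
      have h3 := hlu s
      simp only [realVec, a, Pi.sub_apply]
      generalize hL : l s = L at *
      generalize hU : u s = U at *
      cases L with
      | bot =>
        have e1 : ql s = 0 := by simp [ql, hL]
        cases U with
        | top =>
          have e2 : qu s = 0 := by simp [qu, hU]
          simp [e1, e2]
        | coe k =>
          have e2 : qu s = q (Sum.inr (Sum.inr s)) := by simp [qu, hU]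
          rw [← e2]
          split_ifs with h
          · simp [e1]
          · have : qu s = 0 := by linarith
            simp [this]
      | coe j =>
        have e1 : ql s = q (Sum.inr (Sum.inl s)) := by simp [ql, hL]
        cases U with
        | top =>
          have e2 : qu s = 0 := by simp [qu, hU]
          rw [← e1, if_neg (by linarith)]
          simp [e2]
        | coe k =>
          have e2 : qu s = q (Sum.inr (Sum.inr s)) := by simp [qu, hU]
          have h4 : (j : ℝ) ≤ k := by exact_mod_cast (extLE_coe j k).1 h3
          rw [← e1, ← e2]
          simp only [WithTop.untopD_coe, WithBot.unbotD_coe]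
          split_ifs with h
          · nlinarith
          · nlinarith
    have htot : q ⬝ᵥ r = -∑ s, (((u s).untopD 0 : ℤ) * q (Sum.inr (Sum.inr s)) -
          ((l s).unbotD 0 : ℤ) * q (Sum.inr (Sum.inl s))) := by
      simp only [dotProduct, r, Fintype.sum_sum_type, Sum.elim_inl, Sum.elim_inr, Pi.zero_apply,
        mul_zero, Finset.sum_const_zero, zero_add, Finset.sum_sub_distrib, mul_neg,
        Finset.sum_neg_distrib]
      simp only [mul_comm]
      ring
    have hle : realVec a ⬝ᵥ (qu - ql) ≤ _ := Finset.sum_le_sum fun s _ => hterm s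
    linarith

end BoxTDI

theorem theorem2p1 {m S : Type*} [Fintype m] [Fintype S] [DecidableEq S]
    (Q : Matrix m S ℤ) (p : m → ℤ)
    (hQ : BoxTDI.IsBoxTDI (BoxTDI.ratMatrix Q) (BoxTDI.ratVec p))
    (z : S → ℤ)
    (hz : BoxTDI.realVec z ∈ BoxTDI.polyhedron (BoxTDI.ratMatrix Q) (BoxTDI.ratVec p))
    (l : S → WithBot ℤ) (u : S → WithTop ℤ) (hlu : ∀ s, BoxTDI.ExtLE (l s) (u s)) :
    ((∃ y : m → ℤ, (∀ i, 0 ≤ y i) ∧ BoxTDI.IsBetween l u (y ᵥ* Q) ∧ y ⬝ᵥ (Q *ᵥ z - p) = 0) ↔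
      BoxTDI.PairCondition
        (BoxTDI.polyhedron (BoxTDI.ratMatrix Q) (BoxTDI.ratVec p)) z l u) ∧
    ((∃ w : S → ℤ, BoxTDI.IsBetween l u w ∧
        BoxTDI.IsMinimizer (BoxTDI.polyhedron (BoxTDI.ratMatrix Q) (BoxTDI.ratVec p))
          (BoxTDI.realVec w) (BoxTDI.realVec z)) ↔
      BoxTDI.PairCondition
        (BoxTDI.polyhedron (BoxTDI.ratMatrix Q) (BoxTDI.ratVec p)) z l u) := by

  have hmin : ∀ y : m → ℤ, (∀ i, 0 ≤ y i) → y ⬝ᵥ (Q *ᵥ z - p) = 0 → _ :=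
    fun y hy hyz => BoxTDI.isMinimizer_of_dual hz hy hyz
  have hdual : BoxTDI.PairCondition (BoxTDI.polyhedron (BoxTDI.ratMatrix Q) (BoxTDI.ratVec p))
      z l u → ∃ y : m → ℤ, (∀ i, 0 ≤ y i) ∧ BoxTDI.IsBetween l u (y ᵥ* Q) ∧
        y ⬝ᵥ (Q *ᵥ z - p) = 0 := fun hcond => by
    obtain ⟨y, hy, hyz, hl, hu⟩ := hQ.exists_real_dual hz hlu hcond
    obtain ⟨y', hy', hyz', hl', hu'⟩ := hQ.exists_int_dual_of_real hz
      -- An infinite bound gives an empty set of constraints.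
      (fun s => {k | l s = WithBot.some k}) (fun s => {k | u s = WithTop.some k}) hy hyz hl hu
    refine ⟨y', hy', fun s => ⟨?_, ?_⟩, hyz'⟩
    · cases h : l s with
      | bot => exact bot_le
      | coe k => exact WithBot.coe_le_coe.2 (hl' s k h)
    · cases h : u s with
      | top => exact le_top
      | coe k => exact WithTop.coe_le_coe.2 (hu' s k h)
  refine ⟨⟨?_, hdual⟩, ?_, fun hcond => ?_⟩
  · rintro ⟨y, hy, hbet, hyz⟩
    exact BoxTDI.pairCondition_of_isMinimizer hbet (hmin y hy hyz)
  · rintro ⟨w, hbet, hw⟩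
    exact BoxTDI.pairCondition_of_isMinimizer hbet hw
  · obtain ⟨y, hy, hbet, hyz⟩ := hdual hcond
    exact ⟨y ᵥ* Q, hbet, hmin y hy hyz⟩
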